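/- Consider a polling system with queues $Q_1,\dots,Q_M$ ($M\ge 1$) and one server visiting them cyclically. Jobs arrive to $Q_j$ according to independent Poisson processes of rates $\lambda_j>0$; service times at $Q_j$ are independent and exponential with mean $b_j>0$ (a service interrupted by the departure of the server is lost and re-sampled at the next visit); after a visit to $Q_j$ there is an independent switch-over time $C^{j}\ge 0$ with a general distribution. Queue indices are cyclic ($Q_0=Q_M$). At a queue $Q_i$ with the time-limited discipline, the server works continuously and leaves as soon as $Q_i$ is empty (immediately, if it finds $Q_i$ empty) or an exponential timer of rate $\alpha_i>0$, started at the beginning of the visit, expires, whichever occurs first. Let $\mathbf N_i^b$ and $\mathbf N_i^e$ be the vectors of queue lengths at the beginning and at the end of a visit to $Q_i$, and write $\mathbf z^{\mathbf n}=z_1^{n_1}\cdots z_M^{n_M}$. For $\mathbf z\in\mathbb C^M$ with $|z_j|\le 1$ for all $j$, put $$s_i=\lambda_i+\tfrac1{b_i}+\alpha_i+\sum_{m\ne i}\lambda_m(1-z_m),\qquad P_i(w)=\lambda_i w^2-s_i w+\tfrac1{b_i},\qquad r_{1i}=\frac{s_i-\sqrt{s_i^2-4\lambda_i/b_i}}{2\lambda_i}$$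 (principal square root), and $\mathbf z_i^*=(z_1,\dots,z_{i-1},r_{1i},z_{i+1},\dots,z_M)$. Fix a queue $Q_i$. Then $|r_{1i}|<1$, and $r_{1i}$ is the only root of $P_i$ in the closed unit disc. If the discipline at $Q_i$ is time-limited, the following hold for all $\mathbf z$ with $|z_j|\le1$ for all $j$ and $P_i(z_i)\ne 0$ (that is, $z_i\neq r_{1i}$). (1) For every $\mathbf n=(n_1,\dots,n_M)\in\mathbb Z_{\ge0}^M$ (including $n_i=0$), $$\mathbb E\big[\mathbf z^{\mathbf N_i^e}\mid \mathbf N_i^b=\mathbf n\big]=\Big(\prod_{j\ne i}z_j^{n_j}\Big)\Big(r_{1i}^{n_i}-\frac{\alpha_i z_i}{P_i(z_i)}\big(z_i^{n_i}-r_{1i}^{n_i}\big)\Big).$$ (2) For every law of $\mathbf N_i^b$, the p.g.f.s $\beta_i(\mathbf z)=\mathbb E[\mathbf z^{\mathbf N_i^b}]$ and $\gamma_i(\mathbf z)=\mathbb E[\mathbf z^{\mathbf N_i^e}]$ satisfy $$\gamma_i(\mathbf z)=\Big(1+\frac{\alpha_i z_i}{P_i(z_i)}\Big)\beta_i(\mathbf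 z_i^*)-\frac{\alpha_i z_i}{P_i(z_i)}\beta_i(\mathbf z).$$ (3) In steady state (whatever the disciplines at the other queues), the steady-state p.g.f.s $\beta^T_i$ and $\gamma^T_i$ at the beginning and end of visits to $Q_i$ satisfy the relation in (2), and, with $\gamma^T_{i-1}$ the steady-state p.g.f. at the end of visits to $Q_{i-1}$ and $C^{i-1}(\mathbf z)$ the joint p.g.f. of the numbers of Poisson arrivals to the queues during the switch-over time $C^{i-1}$, $$\gamma^T_i(\mathbf z)=\Big(1+\frac{\alpha_i z_i}{P_i(z_i)}\Big)\gamma^T_{i-1}(\mathbf z_i^*)\,C^{i-1}(\mathbf z_i^*)-\frac{\alpha_i z_i}{P_i(z_i)}\gamma^T_{i-1}(\mathbf z)\,C^{i-1}(\mathbf z).$$ -/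

import Mathlib

open MeasureTheory ProbabilityTheory

namespace Polling

/-- A joint queue length: `n j` is the number of jobs in queue `j`. -/
abbrev State (M : ℕ) := Fin M → ℕ

/-- The parameters of a polling system with `M` queues: Poisson arrival rates `lam j`, mean
service times `b j` (exponential service), rates `alpha j` of the exponential visit timers, and
the distribution `C j` of the switch-over time from queue `j` to queue `j + 1` (cyclically). -/
structure Model (M : ℕ) where
  lam : Fin M → ℝ
  b : Fin M → ℝ
  alpha : Fin M → ℝ
  C : Fin M → Measure ℝ
  lam_pos : ∀ j, 0 < lam j
  b_pos : ∀ j, 0 < b j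
  alpha_pos : ∀ j, 0 < alpha j
  C_prob : ∀ j, IsProbabilityMeasure (C j)
  C_nonneg : ∀ j, ∀ᵐ t ∂(C j), 0 ≤ t

/-- Number of events in `[0, t]` of the point process on the half-line whose successive
inter-event times are `E 0, E 1, E 2, …`. -/
noncomputable def count (E : ℕ → ℝ) (t : ℝ) : ℕ :=
  Set.ncard {k : ℕ | ∑ l ∈ Finset.range (k + 1), E l ≤ t}

/-- The random times which drive one visit of the server to a queue: the inter-arrival times of
every queue, the service times at the visited queue, and the timer. -/
inductive Clock (M : ℕ) where
  | arrival (j : Fin M) (k : ℕ) : Clock M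
  | service (k : ℕ) : Clock M
  | timer : Clock M

namespace Model

variable {M : ℕ} (P : Model M)

/-- Rate of the exponential distribution of each clock, for a visit to queue `i`. -/
noncomputable def rate (i : Fin M) : Clock M → ℝ
  | .arrival j _ => P.lam j
  | .service _ => 1 / P.b i
  | .timer => P.alpha i

theorem rate_pos (i : Fin M) (c : Clock M) : 0 < P.rate i c := by
  cases c with
  | arrival j k => exact P.lam_pos j
  | service k => exact one_div_pos.mpr (P.b_pos i)
  | timer => exact P.alpha_pos i

instance instProbRate (i : Fin M) (c : Clock M) :
    IsProbabilityMeasure (expMeasure (P.rate i c)) :=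
  isProbabilityMeasure_expMeasure (P.rate_pos i c)

instance instProbLam (j : Fin M) : IsProbabilityMeasure (expMeasure (P.lam j)) :=
  isProbabilityMeasure_expMeasure (P.lam_pos j)

/-- Joint law of the clocks of a visit to queue `i`: independent exponential variables. -/
noncomputable def clockLaw (i : Fin M) : Measure (Clock M → ℝ) :=
  Measure.infinitePi fun c => expMeasure (P.rate i c)

end Model

/-- Number of arrivals to queue `j` during the first `t` time units of a visit. -/
noncomputable def arrivals {M : ℕ} (ω : Clock M → ℝ) (j : Fin M) (t : ℝ) : ℕ :=
  count (fun k => ω (.arrival j k)) t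

/-- Number of services completed during the first `t` time units of a visit, as long as the
visited queue has not become empty (the server then works without interruption). -/
noncomputable def services {M : ℕ} (ω : Clock M → ℝ) (t : ℝ) : ℕ :=
  count (fun k => ω (.service k)) t

/-- Duration of a time-limited visit to queue `i` which finds the queue lengths `n`: the first
time at which the timer has expired or queue `i` is empty (time `0` if `n i = 0`). -/
noncomputable def visitTime {M : ℕ} (i : Fin M) (n : State M) (ω : Clock M → ℝ) : ℝ :=
  sInf {t : ℝ | 0 ≤ t ∧ (ω .timer ≤ t ∨ n i + arrivals ω i t ≤ services ω t)}

/-- Queue lengths at the end of a time-limited visit to queue `i` which finds the queue lengths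
`n`; a service in progress when the timer expires is lost, and the job stays in the queue. -/
noncomputable def endState {M : ℕ} (i : Fin M) (n : State M) (ω : Clock M → ℝ) : State M :=
  fun j => n j + arrivals ω j (visitTime i n ω)
    - (if j = i then services ω (visitTime i n ω) else 0)

namespace Model

variable {M : ℕ} (P : Model M)

/-- The time-limited discipline at queue `i`: conditional law of the queue lengths at the end of
a visit to queue `i` given the queue lengths at its beginning. -/
noncomputable def timeLimited (i : Fin M) : Kernel (State M) (State M) :=
  Kernel.ofFunOfCountable fun n => (P.clockLaw i).map (endState i n)

/-- Law of the numbers of arrivals to the queues during the switch-over time that follows a visit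
to queue `i`. -/
noncomputable def switchArrivals (i : Fin M) : Measure (State M) :=
  ((P.C i).prod (Measure.infinitePi fun c : Fin M × ℕ => expMeasure (P.lam c.1))).map
    fun p => fun j => count (fun k => p.2 (j, k)) p.1

/-- Steady state at the polling epochs. The kernel `V i` is the conditional law of the queue
lengths at the end of a visit to queue `i` given those at its beginning, as determined by the
service discipline of that queue. The measures `begin_ i` and `end_ i` are the steady-state laws
of the queue lengths at the beginning and at the end of a visit to queue `i`, queue `i` being
reached from queue `i - 1` (cyclically) after the switch-over time of queue `i - 1`. -/
structure IsSteadyState [NeZero M] (V : Fin M → Kernel (State M) (State M))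
    (begin_ end_ : Fin M → Measure (State M)) : Prop where
  prob_begin : ∀ i, IsProbabilityMeasure (begin_ i)
  prob_end : ∀ i, IsProbabilityMeasure (end_ i)
  visit : ∀ i, end_ i = (begin_ i).bind (V i)
  switch : ∀ i, begin_ i = (end_ (i - 1)).conv (P.switchArrivals (i - 1))

/-- The coefficient `s_i = λ_i + 1/b_i + α_i + ∑_{m ≠ i} λ_m (1 - z_m)`. -/
noncomputable def s (i : Fin M) (z : Fin M → ℂ) : ℂ :=
  P.lam i + 1 / P.b i + P.alpha i + ∑ m ∈ Finset.univ.erase i, P.lam m * (1 - z m)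

/-- The polynomial `P_i(w) = λ_i w² - s_i w + 1/b_i`. -/
noncomputable def poly (i : Fin M) (z : Fin M → ℂ) (w : ℂ) : ℂ :=
  P.lam i * w ^ 2 - P.s i z * w + 1 / P.b i

/-- The root `r_{1i} = (s_i - √(s_i² - 4 λ_i / b_i)) / (2 λ_i)` of `P_i` (principal square
root). -/
noncomputable def root (i : Fin M) (z : Fin M → ℂ) : ℂ :=
  (P.s i z - Complex.sqrt (P.s i z ^ 2 - 4 * P.lam i / P.b i)) / (2 * P.lam i)

/-- The point `z*_i`: the `i`-th coordinate of `z` is replaced by `r_{1i}`. -/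
noncomputable def star (i : Fin M) (z : Fin M → ℂ) : Fin M → ℂ :=
  Function.update z i (P.root i z)

end Model

/-- Joint probability generating function `E[z_1^{N_1} ⋯ z_M^{N_M}]` of a law on `State M`. -/
noncomputable def pgf {M : ℕ} (ν : Measure (State M)) (z : Fin M → ℂ) : ℂ :=
  ∫ n, ∏ j, z j ^ n j ∂ν

end Polling

/-!
During a time-limited visit to queue `i` all random times are exponential, so the visit can be
analysed at its first event: the expiry of the timer, a service completion, or an arrival to some
queue. Write `F n` for the p.g.f. of the final queue lengths of a visit which finds `n`, and
`Λ = α_i + 1/b_i + ∑ j, λ_j`. If `n i = 0`, then `F n = z ^ n`; otherwise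
`Λ F n = α_i z ^ n + (1/b_i) F (n - e_i) + ∑ j, λ_j F (n + e_j)`.
The closed form `endPgf` satisfies the same equations (`totalRate_mul_endPgf`), because `r_{1i}` is a
root of `P_i`. Both functions are bounded, and since `α_i > 0` the equations determine a bounded
solution uniquely (`eq_zero_of_first_step`: the step contracts the supremum norm by the factor
`(Λ - α_i) / Λ`).

The first-step equation for `F` rests on two facts. In law: given that one of finitely many
independent exponential clocks rings first, the residual clocks have the original joint law
(`map_residual_restrict`). Path by path: outside a null set, the visit after its first event is the
visit driven by the residual clocks, started from the updated queue lengths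
(`endState_eq_endState_residual`).

The root `r_{1i}` has modulus less than `1` without any appeal to Rouché's theorem: the two roots
`v`, `w` of `P_i` satisfy `‖v + w‖ > 1 + ‖v‖ ‖w‖`, so that `(1 - ‖v‖) (1 - ‖w‖) < 0`, and the
principal square root makes `r_{1i}` the smaller one.

The relations for an arbitrary initial law and in steady state follow by integration, and because the
p.g.f. of a convolution is the product of the p.g.f.s.
-/

/-! ### The root of the kernel polynomial -/

namespace Polling

/-- The triangle inequality `‖v + w‖ ≤ ‖v‖ + ‖w‖` turns the hypothesis into
`(1 - ‖v‖) (1 - ‖w‖) < 0`. -/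
theorem norm_lt_one_of_norm_add_gt {v w : ℂ} (hvw : ‖v‖ ≤ ‖w‖) (h : 1 + ‖v‖ * ‖w‖ < ‖v + w‖) :
    ‖v‖ < 1 ∧ 1 < ‖w‖ := by
  have h1 := norm_add_le v w
  have h2 : (1 - ‖v‖) * (1 - ‖w‖) < 0 := by nlinarith
  constructor <;> by_contra! h3 <;> nlinarith

/-- Of the two roots given by the quadratic formula, the one with the minus sign in front of the
principal square root has the smaller modulus, when `s` lies in the right half plane and the
constant term is real and positive. -/
theorem norm_sub_le_norm_add_of_sq {s D : ℂ} {c : ℝ} (hs : 0 < s.re) (hD : 0 ≤ D.re)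
    (h : D ^ 2 = s ^ 2 - c) : ‖s - D‖ ≤ ‖s + D‖ := by
  have him : s.re * s.im = D.re * D.im := by
    have := congrArg Complex.im h
    simp [pow_two] at this
    linarith
  have h0 : 0 ≤ s.im * D.im := by
    have : s.re * (s.im * D.im) = D.re * D.im ^ 2 := by rw [← mul_assoc, him]; ring
    have h2 : 0 ≤ s.re * (s.im * D.im) := by rw [this]; positivity
    exact nonneg_of_mul_nonneg_right h2 hs
  rw [← sq_le_sq₀ (norm_nonneg _) (norm_nonneg _), Complex.sq_norm, Complex.sq_norm,
    Complex.normSq_apply, Complex.normSq_apply]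
  simp only [Complex.sub_re, Complex.sub_im, Complex.add_re, Complex.add_im]
  nlinarith [mul_nonneg hs.le hD]

namespace Model

variable {M : ℕ} (P : Model M) (i : Fin M) {z : Fin M → ℂ}

theorem lt_re_s (hz : ∀ j, ‖z j‖ ≤ 1) : P.lam i + 1 / P.b i < (P.s i z).re := by
  have h : 0 ≤ ∑ m ∈ Finset.univ.erase i, P.lam m * (1 - (z m).re) :=
    Finset.sum_nonneg fun m _ =>
      mul_nonneg (P.lam_pos m).le (sub_nonneg.2 ((Complex.re_le_norm _).trans (hz m)))
  have h' : (P.s i z).re = P.lam i + 1 / P.b i + P.alpha i +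
      ∑ m ∈ Finset.univ.erase i, P.lam m * (1 - (z m).re) := by
    have : P.s i z = ((P.lam i + 1 / P.b i + P.alpha i : ℝ) : ℂ) +
        ∑ m ∈ Finset.univ.erase i, P.lam m * (1 - z m) := by simp [s]
    rw [this, Complex.add_re, Complex.ofReal_re, Complex.re_sum]
    simp
  linarith [P.alpha_pos i]

/-- The polynomial factors over its roots `root i z` and `w`, which lie strictly inside and
strictly outside of the closed unit disc. -/
theorem exists_poly_factor (hz : ∀ j, ‖z j‖ ≤ 1) : ‖P.root i z‖ < 1 ∧ ∃ w : ℂ, 1 < ‖w‖ ∧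
    ∀ x, P.poly i z x = P.lam i * ((x - P.root i z) * (x - w)) := by
  have hl := P.lam_pos i
  have hb := P.b_pos i
  have hs := P.lt_re_s i hz
  have hlC : (P.lam i : ℂ) ≠ 0 := by exact_mod_cast hl.ne'
  set S := P.s i z with hS
  set D := Complex.sqrt (S ^ 2 - 4 * P.lam i / P.b i) with hDdef
  have hD2 : D ^ 2 = S ^ 2 - 4 * P.lam i / P.b i := by
    rw [hDdef, Complex.sqrt]
    exact Complex.cpow_ofNat_inv_pow _ 2
  have hDre : 0 ≤ D.re := by
    rw [hDdef, Complex.sqrt, Complex.cpow_inv_two_re]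
    positivity
  have hroot : P.root i z = (S - D) / (2 * P.lam i) := rfl
  set w := (S + D) / (2 * P.lam i) with hw
  have hadd : P.root i z + w = S / P.lam i := by rw [hroot, hw]; field_simp; ring
  have hmul : P.root i z * w = 1 / (P.b i * P.lam i) := by
    have hbC : (P.b i : ℂ) ≠ 0 := by exact_mod_cast hb.ne'
    have : P.root i z * w = (S ^ 2 - D ^ 2) / (4 * P.lam i ^ 2) := by
      rw [hroot, hw]; field_simp; ring
    rw [this, hD2]; field_simp; ring
  have hle : ‖P.root i z‖ ≤ ‖w‖ := by
    rw [hroot, hw, norm_div, norm_div]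
    gcongr
    refine norm_sub_le_norm_add_of_sq (c := 4 * P.lam i / P.b i)
      (hs.trans' (by positivity)) hDre ?_
    rw [hD2]; push_cast; rfl
  have hgt : 1 + ‖P.root i z‖ * ‖w‖ < ‖P.root i z + w‖ := by
    rw [← norm_mul, hmul, hadd, norm_div, norm_div, norm_mul, Complex.norm_real, Complex.norm_real,
      Real.norm_of_nonneg hl.le, Real.norm_of_nonneg hb.le, norm_one, lt_div_iff₀ hl]
    have : (1 + 1 / (P.b i * P.lam i)) * P.lam i = P.lam i + 1 / P.b i := by field_simp
    rw [this]
    exact hs.trans_le (Complex.re_le_norm _)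
  obtain ⟨h1, h2⟩ := norm_lt_one_of_norm_add_gt hle hgt
  refine ⟨h1, w, h2, fun x => ?_⟩
  have e : P.lam i * ((x - P.root i z) * (x - w)) =
      P.lam i * x ^ 2 - P.lam i * (P.root i z + w) * x + P.lam i * (P.root i z * w) := by ring
  rw [e, hadd, hmul, poly, ← hS]
  have hbC : (P.b i : ℂ) ≠ 0 := by exact_mod_cast hb.ne'
  field_simp

theorem norm_root_lt_one (hz : ∀ j, ‖z j‖ ≤ 1) : ‖P.root i z‖ < 1 :=
  (P.exists_poly_factor i hz).1

theorem poly_eq_zero_iff (hz : ∀ j, ‖z j‖ ≤ 1) {w : ℂ} (hw : ‖w‖ ≤ 1) :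
    P.poly i z w = 0 ↔ w = P.root i z := by
  obtain ⟨-, v, hv, h⟩ := P.exists_poly_factor i hz
  have hlC : (P.lam i : ℂ) ≠ 0 := by exact_mod_cast (P.lam_pos i).ne'
  have hwv : w - v ≠ 0 := by
    rw [sub_ne_zero]
    rintro rfl
    linarith
  rw [h, mul_eq_zero, mul_eq_zero, sub_eq_zero]
  tauto

/-- The closed form of the conditional p.g.f. at the end of a visit to queue `i` which finds the
queue lengths `n`. -/
noncomputable def endPgf (z : Fin M → ℂ) (n : State M) : ℂ :=
  (∏ j ∈ Finset.univ.erase i, z j ^ n j) *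
    (P.root i z ^ n i - P.alpha i * z i / P.poly i z (z i) * (z i ^ n i - P.root i z ^ n i))

theorem endPgf_of_eq_zero {n : State M} (hn : n i = 0) : P.endPgf i z n = ∏ j, z j ^ n j := by
  rw [← Finset.mul_prod_erase _ _ (Finset.mem_univ i)]
  simp [endPgf, hn]

/-- The total rate of the exponential clocks that compete during a visit to queue `i`. -/
noncomputable def totalRate : ℝ := P.alpha i + (1 / P.b i + ∑ j, P.lam j)

/-- The closed form satisfies the first-step equation of the visit: up to the first event, which
is the expiry of the timer, a service completion or an arrival, nothing changes. -/
theorem totalRate_mul_endPgf (hz : ∀ j, ‖z j‖ ≤ 1) (hP : P.poly i z (z i) ≠ 0) {n : State M}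
    (hn : n i ≠ 0) :
    P.totalRate i * P.endPgf i z n = P.alpha i * ∏ j, z j ^ n j +
      (1 / P.b i * P.endPgf i z (n - Pi.single i 1) +
        ∑ j, P.lam j * P.endPgf i z (n + Pi.single j 1)) := by
  obtain ⟨m, hm : n i = m + 1⟩ := Nat.exists_eq_succ_of_ne_zero hn
  set Q := ∏ j ∈ Finset.univ.erase i, z j ^ n j with hQ
  set A := P.alpha i * z i / P.poly i z (z i) with hA
  have hdown : P.endPgf i z (n - Pi.single i 1) =
      Q * (P.root i z ^ m - A * (z i ^ m - P.root i z ^ m)) := by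
    have : ∏ j ∈ Finset.univ.erase i, z j ^ (n - Pi.single i 1 : State M) j = Q :=
      Finset.prod_congr rfl fun j hj => by simp [Finset.ne_of_mem_erase hj]
    rw [endPgf, this]
    simp [hm, hA]
  have hup : P.endPgf i z (n + Pi.single i 1) =
      Q * (P.root i z ^ (m + 2) - A * (z i ^ (m + 2) - P.root i z ^ (m + 2))) := by
    have : ∏ j ∈ Finset.univ.erase i, z j ^ (n + Pi.single i 1 : State M) j = Q :=
      Finset.prod_congr rfl fun j hj => by simp [Finset.ne_of_mem_erase hj]
    rw [endPgf, this]
    simp [hm, hA]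
  have hother : ∀ j ∈ Finset.univ.erase i, P.lam j * P.endPgf i z (n + Pi.single j 1) =
      P.lam j * z j * P.endPgf i z n := fun j hj => by
    have hji : j ≠ i := Finset.ne_of_mem_erase hj
    have : ∏ l ∈ Finset.univ.erase i, z l ^ (n + Pi.single j 1 : State M) l = z j * Q := by
      rw [hQ, ← Finset.mul_prod_erase _ _ hj, ← Finset.mul_prod_erase _ (fun l => z l ^ n l) hj,
        ← mul_assoc]
      congr 1
      · simp [pow_succ']
      · exact Finset.prod_congr rfl fun l hl => by simp [Finset.ne_of_mem_erase hl]
    rw [endPgf, endPgf, this]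
    simp only [Pi.add_apply, Pi.single_eq_of_ne hji.symm, add_zero]
    ring
  have hn' : P.endPgf i z n =
      Q * (P.root i z ^ (m + 1) - A * (z i ^ (m + 1) - P.root i z ^ (m + 1))) := by
    rw [endPgf, hm]
  have hroot : P.poly i z (P.root i z) = 0 :=
    (P.poly_eq_zero_iff i hz (P.norm_root_lt_one i hz).le).2 rfl
  have hAP : A * P.poly i z (z i) = P.alpha i * z i := div_mul_cancel₀ _ hP
  have hs : P.s i z = P.lam i + 1 / P.b i + P.alpha i + ∑ j ∈ Finset.univ.erase i, (P.lam j : ℂ) -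
      ∑ j ∈ Finset.univ.erase i, P.lam j * z j := by
    rw [s, add_sub_assoc, ← Finset.sum_sub_distrib]
    simp only [mul_sub, mul_one]
  have hT : (P.totalRate i : ℂ) = P.alpha i + (1 / P.b i +
      (P.lam i + ∑ j ∈ Finset.univ.erase i, (P.lam j : ℂ))) := by
    rw [Finset.add_sum_erase _ (fun j => (P.lam j : ℂ)) (Finset.mem_univ i), totalRate]
    push_cast
    rfl
  rw [← Finset.add_sum_erase _ _ (Finset.mem_univ i), Finset.sum_congr rfl hother,
    ← Finset.sum_mul, ← Finset.mul_prod_erase _ _ (Finset.mem_univ i), ← hQ, hup, hdown, hn', hT, hm]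
  simp only [poly] at hroot hAP
  rw [hs] at hroot hAP
  linear_combination (-Q * P.root i z ^ m * (1 + A)) * hroot + Q * z i ^ m * hAP

end Model
end Polling

/-! ### Competing exponential clocks -/

namespace Polling

open scoped ENNReal

theorem expMeasure_apply {r : ℝ} {t : Set ℝ} (ht : MeasurableSet t) :
    expMeasure r t = ∫⁻ x, t.indicator (exponentialPDF r) x := by
  rw [lintegral_indicator ht]
  exact withDensity_apply _ ht

/-- Memorylessness of the exponential distribution. -/
theorem expMeasure_shift (r : ℝ) {τ : ℝ} (hτ : 0 ≤ τ) {t : Set ℝ}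
    (ht : MeasurableSet t) :
    expMeasure r {x | τ < x ∧ x - τ ∈ t} = ENNReal.ofReal (Real.exp (-(r * τ))) * expMeasure r t := by
  have hA : MeasurableSet {x | τ < x ∧ x - τ ∈ t} :=
    measurableSet_Ioi.inter ((measurable_id.sub_const τ) ht)
  rw [expMeasure_apply hA, expMeasure_apply ht, ← lintegral_const_mul' _ _ ENNReal.ofReal_ne_top,
    ← lintegral_add_right_eq_self _ τ]
  refine lintegral_congr_ae ?_
  filter_upwards [Measure.ae_ne volume (0 : ℝ)] with y hy
  rcases lt_or_gt_of_ne hy with h | h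
  · have : y + τ ∉ {x | τ < x ∧ x - τ ∈ t} := fun h' => by
      have := h'.1
      linarith
    by_cases hyt : y ∈ t <;> simp [Set.indicator_of_notMem this, hyt, exponentialPDF_of_neg h]
  · by_cases hyt : y ∈ t
    · have : y + τ ∈ {x | τ < x ∧ x - τ ∈ t} := ⟨by linarith, by simpa using hyt⟩
      rw [Set.indicator_of_mem this, Set.indicator_of_mem hyt, exponentialPDF_of_nonneg h.le,
        exponentialPDF_of_nonneg (by linarith), ← ENNReal.ofReal_mul (Real.exp_pos _).le]
      congr 1
      rw [mul_left_comm, ← Real.exp_add]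
      ring_nf
    · have : y + τ ∉ {x | τ < x ∧ x - τ ∈ t} := fun h' => hyt (by simpa using h'.2)
      rw [Set.indicator_of_notMem this, Set.indicator_of_notMem hyt, mul_zero]

theorem expMeasure_Ioi {r : ℝ} (hr : 0 < r) {τ : ℝ} (hτ : 0 ≤ τ) :
    expMeasure r (Set.Ioi τ) = ENNReal.ofReal (Real.exp (-(r * τ))) := by
  have := isProbabilityMeasure_expMeasure hr
  simpa [Set.Ioi] using expMeasure_shift r hτ MeasurableSet.univ

theorem ae_expMeasure_pos {r : ℝ} (hr : 0 < r) : ∀ᵐ x ∂expMeasure r, 0 < x := by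
  have := isProbabilityMeasure_expMeasure hr
  refine (mem_ae_iff_prob_eq_one measurableSet_Ioi).2 ?_
  rw [expMeasure_Ioi hr le_rfl]
  simp

/-- Laplace transform of the exponential distribution. -/
theorem lintegral_exp_neg_expMeasure {r : ℝ} (hr : 0 < r) {R : ℝ} (hR : 0 ≤ R) :
    ∫⁻ x, ENNReal.ofReal (Real.exp (-(R * x))) ∂expMeasure r = ENNReal.ofReal (r / (r + R)) := by
  have h : ∀ x, exponentialPDF r x * ENNReal.ofReal (Real.exp (-(R * x))) =
      ENNReal.ofReal (r / (r + R)) * exponentialPDF (r + R) x := fun x => by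
    rcases lt_or_ge x 0 with hx | hx
    · simp [exponentialPDF_of_neg hx]
    · rw [exponentialPDF_of_nonneg hx, exponentialPDF_of_nonneg hx,
        ← ENNReal.ofReal_mul (by positivity), ← ENNReal.ofReal_mul (by positivity), mul_assoc,
        ← Real.exp_add]
      congr 1
      have : r + R ≠ 0 := by positivity
      field_simp
      ring_nf
  have hm : Measurable (exponentialPDF r) :=
    (measurable_exponentialPDFReal r).ennreal_ofReal
  have : expMeasure r = volume.withDensity (exponentialPDF r) := rfl
  rw [this, lintegral_withDensity_eq_lintegral_mul _ hm (by fun_prop)]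
  simp only [Pi.mul_apply, h]
  rw [lintegral_const_mul' _ _ ENNReal.ofReal_ne_top,
    lintegral_exponentialPDF_eq_one (by positivity), mul_one]

variable {ι : Type*} [DecidableEq ι]

theorem measurable_update_prod (c : ι) :
    Measurable fun p : ℝ × (ι → ℝ) => Function.update p.2 c p.1 := by
  refine measurable_pi_lambda _ fun d => ?_
  by_cases h : d = c
  · subst h; simpa using measurable_fst
  · simp only [Function.update_of_ne h]
    fun_prop

/-- Resampling one coordinate of a product measure. -/
theorem map_update_infinitePi (μ : ι → Measure ℝ) [∀ d, IsProbabilityMeasure (μ d)] (c : ι) :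
    ((μ c).prod (Measure.infinitePi μ)).map (fun p => Function.update p.2 c p.1) =
      Measure.infinitePi μ := by
  have hm := measurable_update_prod c
  refine Measure.eq_infinitePi μ fun s t ht => ?_
  rw [Measure.map_apply hm (MeasurableSet.pi s.countable_toSet fun d _ => ht d)]
  have : (fun p : ℝ × (ι → ℝ) => Function.update p.2 c p.1) ⁻¹' (Set.pi s t) =
      (if c ∈ s then t c else Set.univ) ×ˢ Set.pi (s.erase c : Finset ι) t := by
    ext ⟨x, ω⟩
    simp only [Set.mem_preimage, Set.mem_pi, Finset.mem_coe, Set.mem_prod, Finset.mem_erase]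
    constructor
    · intro h
      refine ⟨?_, fun d hd => ?_⟩
      · split_ifs with hc
        · simpa using h c hc
        · trivial
      · simpa [Function.update_of_ne hd.1] using h d hd.2
    · rintro ⟨h1, h2⟩ d hd
      by_cases hdc : d = c
      · subst hdc; simpa [hd] using h1
      · simpa [Function.update_of_ne hdc] using h2 d ⟨hdc, hd⟩
  rw [this, Measure.prod_prod, Measure.infinitePi_pi _ fun d _ => ht d]
  split_ifs with hc
  · exact Finset.mul_prod_erase s (fun d => μ d (t d)) hc
  · simp [Finset.erase_eq_of_notMem hc]

/-- The clocks that remain after clock `c` has rung first among the clocks in `H`: the other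
clocks in `H` lose the elapsed time `ω c`. The map `φ` relabels the clocks, so as to replace the
clock which has rung by a fresh one. -/
def residual (H : Finset ι) (c : ι) (φ : ι → ι) (ω : ι → ℝ) : ι → ℝ :=
  fun d => ω (φ d) - if d ∈ H.erase c then ω c else 0

/-- The event that clock `c` rings strictly before the other clocks in `H`. -/
def ringsFirst (H : Finset ι) (c : ι) : Set (ι → ℝ) := {ω | ∀ d ∈ H.erase c, ω c < ω d}

theorem measurable_residual (H : Finset ι) (c : ι) (φ : ι → ι) : Measurable (residual H c φ) := by
  refine measurable_pi_lambda _ fun d => ?_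
  by_cases h : d ∈ H.erase c <;> simp only [residual, h, if_true, if_false] <;> fun_prop

theorem measurableSet_ringsFirst (H : Finset ι) (c : ι) : MeasurableSet (ringsFirst H c) := by
  have : ringsFirst H c = ⋂ d ∈ H.erase c, {ω : ι → ℝ | ω c < ω d} := by
    ext ω; simp [ringsFirst]
  rw [this]
  exact Finset.measurableSet_biInter _ fun d _ =>
    measurableSet_lt (measurable_pi_apply c) (measurable_pi_apply d)

variable {r : ι → ℝ} [∀ d, IsProbabilityMeasure (expMeasure (r d))]

/-- Independent exponential clocks: the probability that `c` rings first among the clocks in `H`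
while the residual clocks lie in a box. The factors are found by conditioning on the time at which
`c` rings, and memorylessness. -/
theorem infinitePi_ringsFirst_inter_residual (hr : ∀ d, 0 < r d) {H : Finset ι} {c : ι}
    (hc : c ∈ H) {φ : ι → ι} (hφ : Function.Injective φ)
    (hφH : ∀ d ∈ H.erase c, φ d = d) (hφr : ∀ d, r (φ d) = r d)
    {s : Finset ι} (hφc : ∀ d ∈ s, φ d ≠ c) {t : ι → Set ℝ} (ht : ∀ d, MeasurableSet (t d)) :
    Measure.infinitePi (fun d => expMeasure (r d))
        (ringsFirst H c ∩ residual H c φ ⁻¹' Set.pi s t) =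
      ENNReal.ofReal (r c / ∑ d ∈ H, r d) * ∏ d ∈ s, expMeasure (r d) (t d) := by
  classical
  set μ := Measure.infinitePi fun d => expMeasure (r d) with hμ
  set t' : ι → Set ℝ := fun d => if d ∈ s then t d else Set.univ with ht'
  have ht'm : ∀ d, MeasurableSet (t' d) := fun d => by
    by_cases h : d ∈ s <;> simp [t', h, ht]
  -- `K` is the set of all clocks on which the event imposes a condition
  set K := s ∪ H.erase c with hK
  -- the admissible values of the clocks, when clock `c` rings at time `x`
  set B : ℝ → ι → Set ℝ := fun x d =>
    if d ∈ H.erase c then {y | x < y ∧ y - x ∈ t' d} else t' d with hB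
  have hBm : ∀ x d, MeasurableSet (B x d) := fun x d => by
    by_cases h : d ∈ H.erase c
    · simp only [B, h, if_true]
      exact measurableSet_Ioi.inter ((measurable_id.sub_const x) (ht'm d))
    · simp only [B, h, if_false]; exact ht'm d
  have hpi : Set.pi (s : Set ι) t = Set.pi (K : Set ι) t' := by
    ext ω
    simp only [Set.mem_pi, Finset.mem_coe, hK, Finset.mem_union]
    constructor
    · intro h d _
      by_cases hd : d ∈ s
      · simpa [t', hd] using h d hd
      · simp [t', hd]
    · intro h d hd
      simpa [t', hd] using h d (Or.inl hd)
  have hprod : ∏ d ∈ s, expMeasure (r d) (t d) = ∏ d ∈ K, expMeasure (r d) (t' d) := by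
    rw [← Finset.prod_subset (Finset.subset_union_left (s₁ := s) (s₂ := H.erase c))]
    · exact Finset.prod_congr rfl fun d hd => by simp [t', hd]
    · intro d _ hd; simp [t', hd]
  set E := ringsFirst H c ∩ residual H c φ ⁻¹' Set.pi s t with hE
  have hEm : MeasurableSet E := (measurableSet_ringsFirst H c).inter
    (measurable_residual H c φ (MeasurableSet.pi s.countable_toSet fun d _ => ht d))
  have hum := measurable_update_prod c
  have hupd : ∀ x (ω : ι → ℝ), ∀ d ∈ K, Function.update ω c x (φ d) = ω (φ d) := fun x ω d hd => by
    rcases Finset.mem_union.1 hd with h | h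
    · exact Function.update_of_ne (hφc d h) _ _
    · rw [hφH d h, Function.update_of_ne (Finset.ne_of_mem_erase h)]
  have hsec : ∀ x, {ω : ι → ℝ | Function.update ω c x ∈ E} =
      Set.pi (K.image φ : Finset ι) (Function.extend φ (B x) fun _ => Set.univ) := fun x => by
    ext ω
    simp only [hE, hpi, Set.mem_ofPred_eq, Set.mem_inter_iff, ringsFirst, Set.mem_preimage,
      Set.mem_pi, Finset.coe_image, Set.mem_image, Finset.mem_coe, forall_exists_index, and_imp,
      forall_apply_eq_imp_iff₂, hφ.extend_apply, residual, Function.update_self]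
    constructor
    · rintro ⟨h1, h2⟩ d hd
      by_cases hdH : d ∈ H.erase c
      · simp only [B, hdH, if_true, Set.mem_ofPred_eq]
        have h2d := h2 d hd
        rw [hupd x ω d hd] at h2d
        have h1d := h1 d hdH
        rw [Function.update_of_ne (Finset.ne_of_mem_erase hdH)] at h1d
        rw [hφH d hdH] at h2d ⊢
        exact ⟨h1d, by simpa only [hdH, if_true] using h2d⟩
      · simpa only [B, hdH, if_false, sub_zero, hupd x ω d hd] using h2 d hd
    · refine fun h => ⟨fun d hd => ?_, fun d hd => ?_⟩
      · have := h d (Finset.mem_union_right _ hd)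
        simp only [B, hd, if_true, Set.mem_ofPred_eq] at this
        rw [Function.update_of_ne (Finset.ne_of_mem_erase hd)]
        rw [hφH d hd] at this
        exact this.1
      · have := h d hd
        rw [hupd x ω d hd]
        by_cases hdH : d ∈ H.erase c
        · simp only [B, hdH, if_true, Set.mem_ofPred_eq] at this
          simpa only [hdH, if_true] using this.2
        · simp only [B, hdH, if_false] at this
          simpa only [hdH, if_false, sub_zero] using this
  have hmeas : ∀ x, 0 ≤ x → μ {ω : ι → ℝ | Function.update ω c x ∈ E} =
      ENNReal.ofReal (Real.exp (-((∑ d ∈ H.erase c, r d) * x))) *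
        ∏ d ∈ K, expMeasure (r d) (t' d) := fun x hx => by
    rw [hsec, hμ, Measure.infinitePi_pi, Finset.prod_image fun a _ b _ h => hφ h]
    · have h1 : ∀ d ∈ K, expMeasure (r (φ d)) (Function.extend φ (B x) (fun _ => Set.univ) (φ d)) =
          (if d ∈ H.erase c then ENNReal.ofReal (Real.exp (-(r d * x))) else 1) *
            expMeasure (r d) (t' d) := fun d _ => by
        rw [hφ.extend_apply, hφr]
        by_cases hdH : d ∈ H.erase c
        · simp only [B, hdH, if_true]
          exact expMeasure_shift _ hx (ht'm d)
        · simp only [B, hdH, if_false, one_mul]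
      rw [Finset.prod_congr rfl h1, Finset.prod_mul_distrib, Finset.prod_ite_mem,
        Finset.inter_eq_right.2 Finset.subset_union_right,
        ← ENNReal.ofReal_prod_of_nonneg fun d _ => (Real.exp_pos _).le, ← Real.exp_sum,
        Finset.sum_neg_distrib, Finset.sum_mul]
    · intro d hd
      obtain ⟨e, -, rfl⟩ := Finset.mem_image.1 hd
      rw [hφ.extend_apply]
      exact hBm x e
  rw [hprod, hμ, ← map_update_infinitePi (fun d => expMeasure (r d)) c, Measure.map_apply hum hEm,
    Measure.prod_apply (hum hEm)]
  have hae : ∀ᵐ x ∂expMeasure (r c),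
      μ (Prod.mk x ⁻¹' ((fun p : ℝ × (ι → ℝ) => Function.update p.2 c p.1) ⁻¹' E)) =
      ENNReal.ofReal (Real.exp (-((∑ d ∈ H.erase c, r d) * x))) *
        ∏ d ∈ K, expMeasure (r d) (t' d) := by
    filter_upwards [ae_expMeasure_pos (hr c)] with x hx
    exact hmeas x hx.le
  rw [lintegral_congr_ae hae, lintegral_mul_const _ (by fun_prop), lintegral_exp_neg_expMeasure (hr c)
    (Finset.sum_nonneg fun d _ => (hr d).le), Finset.add_sum_erase _ _ hc]

theorem infinitePi_ringsFirst (hr : ∀ d, 0 < r d) {H : Finset ι} {c : ι} (hc : c ∈ H) :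
    Measure.infinitePi (fun d => expMeasure (r d)) (ringsFirst H c) =
      ENNReal.ofReal (r c / ∑ d ∈ H, r d) := by
  simpa using infinitePi_ringsFirst_inter_residual hr hc Function.injective_id (fun _ _ => rfl)
    (fun _ => rfl) (s := ∅) (by simp) (t := fun _ => Set.univ) fun _ => MeasurableSet.univ

/-- Given that clock `c` rings first among the clocks in `H`, the residual clocks have the same
law as the original ones. -/
theorem map_residual_restrict (hr : ∀ d, 0 < r d) {H : Finset ι} {c : ι}
    (hc : c ∈ H) {φ : ι → ι} (hφ : Function.Injective φ)
    (hφH : ∀ d ∈ H.erase c, φ d = d) (hφr : ∀ d, r (φ d) = r d) (hφc : ∀ d, φ d ≠ c) :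
    ((Measure.infinitePi fun d => expMeasure (r d)).restrict (ringsFirst H c)).map
        (residual H c φ) =
      ENNReal.ofReal (r c / ∑ d ∈ H, r d) • Measure.infinitePi fun d => expMeasure (r d) := by
  have hp : 0 < r c / ∑ d ∈ H, r d := div_pos (hr c) (Finset.sum_pos (fun d _ => hr d) ⟨c, hc⟩)
  set p := ENNReal.ofReal (r c / ∑ d ∈ H, r d)
  have hp0 : p ≠ 0 := (ENNReal.ofReal_pos.2 hp).ne'
  have hpt : p ≠ ∞ := ENNReal.ofReal_ne_top
  have key : p⁻¹ • ((Measure.infinitePi fun d => expMeasure (r d)).restrict (ringsFirst H c)).map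
      (residual H c φ) = Measure.infinitePi fun d => expMeasure (r d) := by
    refine Measure.eq_infinitePi _ fun s t ht => ?_
    have hm := MeasurableSet.pi s.countable_toSet fun d _ => ht d
    rw [Measure.smul_apply, Measure.map_apply (measurable_residual H c φ) hm,
      Measure.restrict_apply (measurable_residual H c φ hm), Set.inter_comm,
      infinitePi_ringsFirst_inter_residual hr hc hφ hφH hφr (fun d _ => hφc d) ht, smul_eq_mul,
      ← mul_assoc, ENNReal.inv_mul_cancel hp0 hpt, one_mul]
  conv_rhs => rw [← key, smul_smul, ENNReal.mul_inv_cancel hp0 hpt, one_smul]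

/-- The strong Markov property at the first ring, in the form in which it is applied. -/
theorem setIntegral_ringsFirst_residual (hr : ∀ d, 0 < r d) {H : Finset ι} {c : ι}
    (hc : c ∈ H) {φ : ι → ι} (hφ : Function.Injective φ)
    (hφH : ∀ d ∈ H.erase c, φ d = d) (hφr : ∀ d, r (φ d) = r d) (hφc : ∀ d, φ d ≠ c)
    {F : (ι → ℝ) → ℂ}
    (hF : AEStronglyMeasurable F (Measure.infinitePi fun d => expMeasure (r d))) :
    ∫ ω in ringsFirst H c, F (residual H c φ ω) ∂Measure.infinitePi (fun d => expMeasure (r d)) =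
      (r c / ∑ d ∈ H, r d : ℝ) * ∫ ω, F ω ∂Measure.infinitePi fun d => expMeasure (r d) := by
  have hp : 0 ≤ r c / ∑ d ∈ H, r d := div_nonneg (hr c).le (Finset.sum_nonneg fun d _ => (hr d).le)
  have hmap := map_residual_restrict hr hc hφ hφH hφr hφc
  rw [← integral_map (measurable_residual H c φ).aemeasurable, hmap, integral_smul_measure,
    ENNReal.toReal_ofReal hp, Complex.real_smul]
  rw [hmap]
  exact hF.smul_measure _

/-- Almost surely exactly one of the clocks in `H` rings first. -/
theorem integral_eq_sum_ringsFirst (hr : ∀ d, 0 < r d) {H : Finset ι} (hH : H.Nonempty)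
    {F : (ι → ℝ) → ℂ} (hF : Integrable F (Measure.infinitePi fun d => expMeasure (r d))) :
    ∫ ω, F ω ∂Measure.infinitePi (fun d => expMeasure (r d)) =
      ∑ c ∈ H, ∫ ω in ringsFirst H c, F ω ∂Measure.infinitePi fun d => expMeasure (r d) := by
  -- the probabilities of these disjoint events add up to `1`, so ties need no separate treatment
  have hdisj : (H : Set ι).PairwiseDisjoint (ringsFirst H) := fun c hc d hd hcd => by
    refine Set.disjoint_left.2 fun ω h1 h2 => ?_
    exact lt_asymm (h1 d (Finset.mem_erase.2 ⟨hcd.symm, hd⟩)) (h2 c (Finset.mem_erase.2 ⟨hcd, hc⟩))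
  have hpos : 0 < ∑ d ∈ H, r d := Finset.sum_pos (fun d _ => hr d) hH
  have hone : Measure.infinitePi (fun d => expMeasure (r d)) (⋃ c ∈ H, ringsFirst H c) = 1 := by
    rw [measure_biUnion_finset hdisj fun c _ => measurableSet_ringsFirst H c,
      Finset.sum_congr rfl fun c hc => infinitePi_ringsFirst hr hc,
      ← ENNReal.ofReal_sum_of_nonneg fun c _ => div_nonneg (hr c).le hpos.le, ← Finset.sum_div,
      div_self hpos.ne', ENNReal.ofReal_one]
  have hm : MeasurableSet (⋃ c ∈ H, ringsFirst H c) :=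
    Finset.measurableSet_biUnion _ fun c _ => measurableSet_ringsFirst H c
  rw [← integral_biUnion_finset _ (fun c _ => measurableSet_ringsFirst H c) hdisj
    fun c _ => hF.integrableOn, Measure.restrict_eq_self_of_ae_mem]
  exact (mem_ae_iff_prob_eq_one hm).2 hone

/-- Almost surely the partial sums of independent exponential variables of the same rate diverge:
they exceed `1` infinitely often. -/
theorem ae_tendsto_sum_atTop {ρ : ℝ} (hr : ∀ d, 0 < r d) {e : ℕ → ι} (he : Function.Injective e)
    (hρ : ∀ k, r (e k) = ρ) :
    ∀ᵐ ω ∂Measure.infinitePi fun d => expMeasure (r d), (∀ k, 0 ≤ ω (e k)) →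
      Filter.Tendsto (fun k => ∑ l ∈ Finset.range k, ω (e l)) Filter.atTop Filter.atTop := by
  have hρ0 : 0 < ρ := hρ 0 ▸ hr _
  have := isProbabilityMeasure_expMeasure hρ0
  have hq : expMeasure ρ (Set.Iic 1) < 1 := by
    rw [← Set.compl_Ioi, prob_compl_eq_one_sub measurableSet_Ioi, expMeasure_Ioi hρ0 zero_le_one]
    exact ENNReal.sub_lt_self ENNReal.one_ne_top one_ne_zero
      (ENNReal.ofReal_pos.2 (Real.exp_pos _)).ne'
  have hfreq : ∀ᵐ ω ∂Measure.infinitePi fun d => expMeasure (r d),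
      ∀ m, ¬ ∀ k, ω (e (m + k)) ∈ Set.Iic (1 : ℝ) := by
    refine ae_all_iff.2 fun m => ?_
    refine measure_mono_null (t := {ω | ∀ k, ω (e (m + k)) ∈ Set.Iic (1 : ℝ)})
      (fun ω h => by simpa using h) ?_
    refine le_antisymm (ge_of_tendsto' (ENNReal.tendsto_pow_atTop_nhds_zero_of_lt_one hq)
      fun N => ?_) zero_le
    have hinj : Function.Injective fun k => e (m + k) := fun a b h => by
      simpa using he h
    calc _ ≤ Measure.infinitePi (fun d => expMeasure (r d))
          (Set.pi ((Finset.range N).image fun k => e (m + k) : Finset ι) fun _ => Set.Iic 1) := by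
            refine measure_mono fun ω h => ?_
            simp only [Set.mem_pi, Finset.coe_image, Set.mem_image, forall_exists_index, and_imp,
              forall_apply_eq_imp_iff₂]
            exact fun k _ => h k
      _ = expMeasure ρ (Set.Iic 1) ^ N := by
        rw [Measure.infinitePi_pi _ fun _ _ => measurableSet_Iic,
          Finset.prod_image fun a _ b _ h => hinj h]
        simp [hρ]
  filter_upwards [hfreq] with ω hω h0
  rw [← not_summable_iff_tendsto_nat_atTop_of_nonneg h0]
  intro hs
  obtain ⟨m, hm⟩ := Filter.eventually_atTop.1
    (hs.tendsto_atTop_zero.eventually_le_const (zero_lt_one' ℝ))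
  exact hω m fun k => hm _ (Nat.le_add_right m k)

end Polling

/-! ### Counting processes -/

namespace Polling

open Filter Topology

theorem count_eq_zero {E : ℕ → ℝ} (hE : ∀ k, 0 ≤ E k) {t : ℝ} (ht : t < E 0) : count E t = 0 := by
  have : {k : ℕ | ∑ l ∈ Finset.range (k + 1), E l ≤ t} = ∅ := by
    refine Set.eq_empty_of_forall_notMem fun k (hk : _ ≤ t) => ?_
    rw [Finset.sum_range_succ'] at hk
    have := Finset.sum_nonneg fun l (_ : l ∈ Finset.range k) => hE (l + 1)
    linarith
  rw [count, this, Set.ncard_empty]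

theorem finite_setOf_sum_le {E : ℕ → ℝ}
    (hE : Tendsto (fun k => ∑ l ∈ Finset.range k, E l) atTop atTop) (t : ℝ) :
    {k : ℕ | ∑ l ∈ Finset.range (k + 1), E l ≤ t}.Finite := by
  have h := ((tendsto_add_atTop_iff_nat 1).2 hE).eventually_gt_atTop t
  rw [← Nat.cofinite_eq_atTop, eventually_cofinite] at h
  simpa using h

/-- Shifting the origin of time shortens the first inter-event time. -/
theorem count_shift (E : ℕ → ℝ) (t τ : ℝ) :
    count (fun k => E k - if k = 0 then τ else 0) (t - τ) = count E t := by
  have : ∀ k, ∑ l ∈ Finset.range (k + 1), (E l - if l = 0 then τ else 0) =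
      ∑ l ∈ Finset.range (k + 1), E l - τ := fun k => by
    rw [Finset.sum_sub_distrib, Finset.sum_ite_eq' (Finset.range (k + 1)) 0]
    simp
  simp only [count, this, sub_le_sub_iff_right]

/-- The first event splits off: the later ones form the point process that starts at its epoch. -/
theorem count_eq_count_tail_add_one {E : ℕ → ℝ}
    (hE : Tendsto (fun k => ∑ l ∈ Finset.range k, E l) atTop atTop) {t : ℝ} (ht : E 0 ≤ t) :
    count E t = count (fun k => E (k + 1)) (t - E 0) + 1 := by
  have hset : {k : ℕ | ∑ l ∈ Finset.range (k + 1), E l ≤ t} =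
      insert 0 (Nat.succ '' {k : ℕ | ∑ l ∈ Finset.range (k + 1), E (l + 1) ≤ t - E 0}) := by
    ext k
    cases k with
    | zero => simpa using ht
    | succ k =>
      simp [Finset.sum_range_succ' _ (k + 1), le_sub_iff_add_le]
  have hfin := finite_setOf_sum_le hE t
  rw [hset] at hfin
  rw [count, hset, Set.ncard_insert_of_notMem (by simp) (hfin.subset (Set.subset_insert _ _)),
    Set.ncard_image_of_injective _ Nat.succ_injective, count]

/-- The counting process is right continuous. -/
theorem eventually_count_eq {E : ℕ → ℝ}
    (hE : Tendsto (fun k => ∑ l ∈ Finset.range k, E l) atTop atTop) (t : ℝ) :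
    ∀ᶠ u in 𝓝[>] t, count E u = count E t := by
  have hfin := finite_setOf_sum_le hE (t + 1)
  have h1 : ∀ᶠ u in 𝓝[>] t, ∀ k ∈ {k : ℕ | ∑ l ∈ Finset.range (k + 1), E l ≤ t + 1},
      (∑ l ∈ Finset.range (k + 1), E l ≤ u ↔ ∑ l ∈ Finset.range (k + 1), E l ≤ t) := by
    refine (eventually_all_finite hfin).2 fun k _ => ?_
    rcases le_or_gt (∑ l ∈ Finset.range (k + 1), E l) t with h | h
    · filter_upwards [self_mem_nhdsWithin] with u (hu : t < u)
      exact iff_of_true (h.trans hu.le) h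
    · filter_upwards [mem_nhdsWithin_of_mem_nhds (Iio_mem_nhds h)] with u hu
      exact iff_of_false (not_le.2 hu) (not_le.2 h)
  filter_upwards [h1, mem_nhdsWithin_of_mem_nhds (Iio_mem_nhds (lt_add_one t))] with u hu
    (hu1 : u < t + 1)
  have : {k : ℕ | ∑ l ∈ Finset.range (k + 1), E l ≤ u} =
      {k : ℕ | ∑ l ∈ Finset.range (k + 1), E l ≤ t} := by
    ext k
    constructor
    · intro (hk : _ ≤ u)
      exact (hu k (hk.trans hu1.le)).1 hk
    · intro (hk : _ ≤ t)
      exact (hu k (hk.trans (lt_add_one t).le)).2 hk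
  rw [count, this, count]

/-- The number of events up to a random time is measurable. -/
theorem measurable_count_comp {Ω : Type*} [MeasurableSpace Ω] {E : Ω → ℕ → ℝ} {t : Ω → ℝ}
    (hE : ∀ k, Measurable fun ω => E ω k) (ht : Measurable t) :
    Measurable fun ω => count (E ω) (t ω) := by
  refine measurable_ncard.comp (measurable_set_iff.2 fun k => ?_)
  exact measurableSet_setOfPred.1 (measurableSet_le
    (Finset.measurable_fun_sum _ fun l _ => hE l) ht)

/-! ### Sample paths of a time-limited visit -/

variable {M : ℕ}

noncomputable instance : DecidableEq (Clock M) := Classical.decEq _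

instance : Countable (Clock M) := by
  refine Function.Injective.countable (β := (Fin M × ℕ) ⊕ (ℕ ⊕ Unit)) (f := fun c => match c with
    | .arrival j k => Sum.inl (j, k)
    | .service k => Sum.inr (Sum.inl k)
    | .timer => Sum.inr (Sum.inr ())) fun a b h => ?_
  cases a <;> cases b <;> simp_all

/-- The sample points outside a null set: all inter-event times are positive and the epochs of the
point processes do not accumulate. -/
structure IsRegular (ω : Clock M → ℝ) : Prop where
  pos : ∀ c, 0 < ω c
  arrival : ∀ j, Tendsto (fun k => ∑ l ∈ Finset.range k, ω (.arrival j l)) atTop atTop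
  service : Tendsto (fun k => ∑ l ∈ Finset.range k, ω (.service l)) atTop atTop

theorem Model.ae_isRegular (P : Model M) (i : Fin M) : ∀ᵐ ω ∂P.clockLaw i, IsRegular ω := by
  have hpos : ∀ᵐ ω ∂P.clockLaw i, ∀ c, 0 < ω c := ae_all_iff.2 fun c =>
    (measurePreserving_eval_infinitePi (fun c => expMeasure (P.rate i c)) c).quasiMeasurePreserving.ae
      (ae_expMeasure_pos (P.rate_pos i c))
  have harr : ∀ᵐ ω ∂P.clockLaw i, ∀ j, (∀ k, 0 ≤ ω (.arrival j k)) →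
      Tendsto (fun k => ∑ l ∈ Finset.range k, ω (.arrival j l)) atTop atTop :=
    ae_all_iff.2 fun j => ae_tendsto_sum_atTop (P.rate_pos i) (e := Clock.arrival j)
      (fun a b h => by simpa using h) fun _ => rfl
  have hser : ∀ᵐ ω ∂P.clockLaw i, (∀ k, 0 ≤ ω (.service k)) →
      Tendsto (fun k => ∑ l ∈ Finset.range k, ω (.service l)) atTop atTop :=
    ae_tendsto_sum_atTop (P.rate_pos i) (e := Clock.service)
      (fun a b h => by simpa using h) fun _ => rfl
  filter_upwards [hpos, harr, hser] with ω h1 h2 h3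
  exact ⟨h1, fun j => h2 j fun k => (h1 _).le, h3 fun k => (h1 _).le⟩

/-- The times at which a visit to queue `i` may have ended; the visit ends at the first of them. -/
def stopSet (i : Fin M) (n : State M) (ω : Clock M → ℝ) : Set ℝ :=
  {t | 0 ≤ t ∧ (ω .timer ≤ t ∨ n i + arrivals ω i t ≤ services ω t)}

theorem bddBelow_stopSet (i : Fin M) (n : State M) (ω : Clock M → ℝ) : BddBelow (stopSet i n ω) :=
  ⟨0, fun _ h => h.1⟩

theorem max_timer_mem_stopSet (i : Fin M) (n : State M) (ω : Clock M → ℝ) :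
    max 0 (ω .timer) ∈ stopSet i n ω := ⟨le_max_left _ _, Or.inl (le_max_right _ _)⟩

theorem visitTime_nonneg (i : Fin M) (n : State M) (ω : Clock M → ℝ) : 0 ≤ visitTime i n ω :=
  Real.sInf_nonneg fun _ h => h.1

/-- On regular paths the first stopping time can be computed from the rational times, by right
continuity. -/
theorem visitTime_eq_iInf {ω : Clock M → ℝ} (hω : IsRegular ω) (i : Fin M) (n : State M)
    [∀ q : ℚ, Decidable ((q : ℝ) ∈ stopSet i n ω)] :
    visitTime i n ω = ⨅ q : ℚ, if (q : ℝ) ∈ stopSet i n ω then (q : ℝ) else max 0 (ω .timer) := by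
  have hmem : ∀ q : ℚ, (if (q : ℝ) ∈ stopSet i n ω then (q : ℝ) else max 0 (ω .timer)) ∈
      stopSet i n ω := fun q => by
    split_ifs with h
    · exact h
    · exact max_timer_mem_stopSet i n ω
  have hbdd : BddBelow (Set.range fun q : ℚ =>
      if (q : ℝ) ∈ stopSet i n ω then (q : ℝ) else max 0 (ω .timer)) :=
    ⟨0, by rintro _ ⟨q, rfl⟩; exact (hmem q).1⟩
  refine le_antisymm (le_ciInf fun q => csInf_le (bddBelow_stopSet i n ω) (hmem q)) ?_
  refine le_csInf ⟨_, max_timer_mem_stopSet i n ω⟩ fun t ht => le_of_forall_gt fun x hx => ?_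
  have hev : ∀ᶠ u in 𝓝[>] t, u ∈ stopSet i n ω := by
    filter_upwards [eventually_count_eq (hω.arrival i) t, eventually_count_eq hω.service t,
      self_mem_nhdsWithin] with u h1 h2 (h3 : t < u)
    refine ⟨ht.1.trans h3.le, ht.2.imp (fun h => h.trans h3.le) fun h => ?_⟩
    rw [arrivals, services, h1, h2]
    exact h
  obtain ⟨y, hy, hyt⟩ := (mem_nhdsGT_iff_exists_Ioo_subset).1 hev
  obtain ⟨q, hq1, hq2⟩ := exists_rat_btwn (lt_min hx hy)
  have hq : (q : ℝ) ∈ stopSet i n ω := hyt ⟨hq1, hq2.trans_le (min_le_right _ _)⟩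
  refine (ciInf_le hbdd q).trans_lt ?_
  rw [if_pos hq]
  exact hq2.trans_le (min_le_left _ _)

/-- In particular the law of `endState` is not the junk value `0` of `Measure.map`. -/
theorem Model.aemeasurable_endState (P : Model M) (i : Fin M) (n : State M) :
    AEMeasurable (endState i n) (P.clockLaw i) := by
  classical
  have harr : ∀ j (t : (Clock M → ℝ) → ℝ), Measurable t →
      Measurable fun ω => arrivals ω j (t ω) := fun j t ht =>
    measurable_count_comp (fun k => measurable_pi_apply _) ht
  have hser : ∀ t : (Clock M → ℝ) → ℝ, Measurable t →
      Measurable fun ω => services ω (t ω) := fun t ht =>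
    measurable_count_comp (fun k => measurable_pi_apply _) ht
  set v : (Clock M → ℝ) → ℝ := fun ω =>
    ⨅ q : ℚ, if (q : ℝ) ∈ stopSet i n ω then (q : ℝ) else max 0 (ω .timer) with hv
  have hvm : Measurable v := by
    refine Measurable.iInf fun q => Measurable.ite ?_ measurable_const
      (measurable_const.max (measurable_pi_apply _))
    have : {ω : Clock M → ℝ | (q : ℝ) ∈ stopSet i n ω} = {_ω | (0 : ℝ) ≤ q} ∩
        ({ω | ω .timer ≤ (q : ℝ)} ∪ {ω | n i + arrivals ω i q ≤ services ω q}) := rfl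
    rw [this]
    exact (MeasurableSet.const _).inter
      ((measurableSet_le (measurable_pi_apply _) measurable_const).union
      (measurableSet_le (measurable_const.add (harr i _ measurable_const))
        (hser _ measurable_const)))
  refine ⟨fun ω j => n j + arrivals ω j (v ω) - if j = i then services ω (v ω) else 0, ?_, ?_⟩
  · refine measurable_pi_lambda _ fun j => ?_
    refine (measurable_const.add (harr j _ hvm)).sub ?_
    by_cases h : j = i
    · simpa only [h, if_true] using hser _ hvm
    · simp only [h, if_false, measurable_const]
  · filter_upwards [P.ae_isRegular i] with ω hω
    funext j
    rw [endState, visitTime_eq_iInf hω]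

/-- The clocks that compete for the first event of a visit. -/
noncomputable def firstClocks (M : ℕ) : Finset (Clock M) :=
  insert .timer (insert (.service 0) (Finset.univ.image fun j => .arrival j 0))

theorem sum_firstClocks {R : Type*} [AddCommMonoid R] (f : Clock M → R) :
    ∑ c ∈ firstClocks M, f c = f .timer + (f (.service 0) + ∑ j, f (.arrival j 0)) := by
  rw [firstClocks, Finset.sum_insert (by simp), Finset.sum_insert (by simp),
    Finset.sum_image fun a _ b _ h => by simpa using h]

/-- The relabelling after clock `c`, the first one of its stream, has rung: the indices of this
stream move up by one, all other clocks stay. The timer has no successor and is never relabelled. -/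
noncomputable def advance (c : Clock M) : Clock M → Clock M
  | .arrival j k => if c = .arrival j 0 then .arrival j (k + 1) else .arrival j k
  | .service k => if c = .service 0 then .service (k + 1) else .service k
  | .timer => .timer

theorem advance_injective (c : Clock M) : Function.Injective (advance c) := by
  intro a b h
  cases a <;> cases b <;> simp only [advance] at h <;> (try split_ifs at h) <;> simp_all

theorem advance_ne {c : Clock M} (hc : c ∈ firstClocks M) (hct : c ≠ .timer) (d : Clock M) :
    advance c d ≠ c := by
  simp only [firstClocks, Finset.mem_insert, hct, Finset.mem_image, Finset.mem_univ, true_and,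
    false_or] at hc
  rcases hc with rfl | ⟨j, rfl⟩ <;> cases d <;> simp only [advance] <;> (try split_ifs) <;>
    simp_all [eq_comm]

theorem advance_of_mem_erase {c : Clock M} {d : Clock M} (hd : d ∈ (firstClocks M).erase c) :
    advance c d = d := by
  obtain ⟨hdc, hd⟩ := Finset.mem_erase.1 hd
  simp only [firstClocks, Finset.mem_insert, Finset.mem_image, Finset.mem_univ, true_and] at hd
  rcases hd with rfl | rfl | ⟨j, rfl⟩
  · rfl
  · simp [advance, hdc.symm]
  · simp [advance, hdc.symm]

theorem Model.rate_advance (P : Model M) (i : Fin M) (c d : Clock M) :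
    P.rate i (advance c d) = P.rate i d := by
  cases d <;> simp only [advance] <;> split_ifs <;> rfl

theorem arrival_mem_firstClocks {j : Fin M} {k : ℕ} : .arrival j k ∈ firstClocks M ↔ k = 0 := by
  simp [firstClocks, eq_comm]

theorem service_mem_firstClocks {k : ℕ} : .service k ∈ firstClocks M ↔ k = 0 := by
  simp [firstClocks]

variable {ω : Clock M → ℝ} {c : Clock M}

theorem arrivals_of_lt (hω : IsRegular ω) (hmin : ω ∈ ringsFirst (firstClocks M) c) {t : ℝ}
    (ht : t < ω c) (j : Fin M) : arrivals ω j t = 0 := by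
  refine count_eq_zero (fun k => (hω.pos _).le) ?_
  by_cases h : Clock.arrival j 0 = c
  · rwa [h]
  · exact ht.trans (hmin _ (Finset.mem_erase.2 ⟨h, arrival_mem_firstClocks.2 rfl⟩))

theorem services_of_lt (hω : IsRegular ω) (hmin : ω ∈ ringsFirst (firstClocks M) c) {t : ℝ}
    (ht : t < ω c) : services ω t = 0 := by
  refine count_eq_zero (fun k => (hω.pos _).le) ?_
  by_cases h : Clock.service 0 = c
  · rwa [h]
  · exact ht.trans (hmin _ (Finset.mem_erase.2 ⟨h, service_mem_firstClocks.2 rfl⟩))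

theorem arrivals_residual (hω : IsRegular ω) (c : Clock M) {t : ℝ} (ht : ω c ≤ t) (j : Fin M) :
    arrivals ω j t = arrivals (residual (firstClocks M) c (advance c) ω) j (t - ω c) +
      if c = .arrival j 0 then 1 else 0 := by
  unfold arrivals
  by_cases h : c = .arrival j 0
  · subst h
    rw [if_pos rfl, count_eq_count_tail_add_one (hω.arrival j) ht]
    congr 2
    funext k
    rw [residual, if_neg]
    · simp [advance]
    · rw [Finset.mem_erase, arrival_mem_firstClocks]
      rintro ⟨h1, rfl⟩
      exact h1 rfl
  · rw [if_neg h, add_zero, ← count_shift _ t (ω c)]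
    congr 1
    funext k
    by_cases hk : k = 0
    · subst hk
      simp [residual, advance, h, Ne.symm h, arrival_mem_firstClocks]
    · simp [residual, advance, h, arrival_mem_firstClocks, hk]

theorem services_residual (hω : IsRegular ω) (c : Clock M) {t : ℝ} (ht : ω c ≤ t) :
    services ω t = services (residual (firstClocks M) c (advance c) ω) (t - ω c) +
      if c = .service 0 then 1 else 0 := by
  unfold services
  by_cases h : c = .service 0
  · subst h
    rw [if_pos rfl, count_eq_count_tail_add_one hω.service ht]
    congr 2
    funext k
    rw [residual, if_neg]
    · simp [advance]
    · rw [Finset.mem_erase, service_mem_firstClocks]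
      rintro ⟨h1, rfl⟩
      exact h1 rfl
  · rw [if_neg h, add_zero, ← count_shift _ t (ω c)]
    congr 1
    funext k
    by_cases hk : k = 0
    · subst hk
      simp [residual, advance, h, Ne.symm h, service_mem_firstClocks]
    · simp [residual, advance, h, service_mem_firstClocks, hk]

theorem residual_timer (hct : c ≠ .timer) :
    residual (firstClocks M) c (advance c) ω .timer = ω .timer - ω c := by
  have : Clock.timer ∈ (firstClocks M).erase c := by simp [firstClocks, hct.symm]
  rw [residual, if_pos this]
  rfl

/-- A visit that finds its queue empty ends immediately. -/
theorem endState_of_eq_zero (hω : IsRegular ω) {i : Fin M} {n : State M} (hn : n i = 0) :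
    endState i n ω = n := by
  have hs : services ω 0 = 0 := count_eq_zero (fun k => (hω.pos _).le) (hω.pos _)
  have ha : ∀ j, arrivals ω j 0 = 0 := fun j =>
    count_eq_zero (fun k => (hω.pos _).le) (hω.pos _)
  have hv : visitTime i n ω = 0 := le_antisymm
    (csInf_le (bddBelow_stopSet i n ω) ⟨le_rfl, Or.inr (by simp [hn, ha])⟩)
    (visitTime_nonneg i n ω)
  funext j
  simp [endState, hv, hs, ha]

/-- While the queue is not empty, the visit lasts at least until the first event. -/
theorem le_of_mem_stopSet (hω : IsRegular ω) (hmin : ω ∈ ringsFirst (firstClocks M) c)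
    {i : Fin M} {n : State M} (hn : n i ≠ 0) {t : ℝ} (ht : t ∈ stopSet i n ω) : ω c ≤ t := by
  by_contra! h
  rcases ht.2 with h1 | h1
  · by_cases hc : Clock.timer = c
    · rw [hc] at h1
      linarith
    · have := hmin _ (Finset.mem_erase.2 ⟨hc, by simp [firstClocks]⟩)
      linarith
  · rw [arrivals_of_lt hω hmin h, services_of_lt hω hmin h] at h1
    omega

/-- If the timer expires before any arrival or service completion, nothing has changed. -/
theorem endState_of_timer_first (hω : IsRegular ω)
    (hmin : ω ∈ ringsFirst (firstClocks M) .timer) {i : Fin M} {n : State M} (hn : n i ≠ 0) :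
    endState i n ω = n := by
  have hv : visitTime i n ω = ω .timer := le_antisymm
    (csInf_le (bddBelow_stopSet i n ω) ⟨(hω.pos _).le, Or.inl le_rfl⟩)
    (le_csInf ⟨_, max_timer_mem_stopSet i n ω⟩ fun t ht => le_of_mem_stopSet hω hmin hn ht)
  have hs : services ω (ω .timer) = 0 := by
    refine count_eq_zero (fun k => (hω.pos _).le) (hmin _ ?_)
    simp [firstClocks]
  have ha : ∀ j, arrivals ω j (ω .timer) = 0 := fun j => by
    refine count_eq_zero (fun k => (hω.pos _).le) (hmin _ ?_)
    simp [firstClocks]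
  funext j
  simp [endState, hv, hs, ha]

/-- If the first event is an arrival or a service completion, the visit continues from the queue
lengths `n'` after this event, driven by the residual clocks. -/
theorem endState_eq_endState_residual (hω : IsRegular ω)
    (hmin : ω ∈ ringsFirst (firstClocks M) c) (hct : c ≠ .timer) {i : Fin M} {n n' : State M}
    (hn : n i ≠ 0) (hn' : ∀ j, n' j + (if c = .service 0 ∧ j = i then 1 else 0) =
      n j + if c = .arrival j 0 then 1 else 0) :
    endState i n ω = endState i n' (residual (firstClocks M) c (advance c) ω) := by
  set ω' := residual (firstClocks M) c (advance c) ω with hω'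
  have hset : ∀ t, ω c ≤ t → (t ∈ stopSet i n ω ↔ t - ω c ∈ stopSet i n' ω') := fun t ht => by
    have h0 : 0 ≤ t := (hω.pos c).le.trans ht
    have := hn' i
    simp only [stopSet, Set.mem_ofPred_eq, h0, sub_nonneg.2 ht, true_and,
      arrivals_residual hω c ht, services_residual hω c ht, ← hω']
    rw [hω', residual_timer hct, sub_le_sub_iff_right, ← hω']
    refine or_congr Iff.rfl ?_
    simp only [and_true] at this
    omega
  have hv : visitTime i n ω = ω c + visitTime i n' ω' := by
    refine le_antisymm ?_ ?_
    · rw [← sub_le_iff_le_add']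
      refine le_csInf ⟨_, max_timer_mem_stopSet i n' ω'⟩ fun t ht => ?_
      rw [sub_le_iff_le_add']
      refine csInf_le (bddBelow_stopSet i n ω) ((hset _ (le_add_of_nonneg_right ht.1)).2 ?_)
      rwa [add_sub_cancel_left]
    · refine le_csInf ⟨_, max_timer_mem_stopSet i n ω⟩ fun t ht => ?_
      rw [← le_sub_iff_add_le']
      exact csInf_le (bddBelow_stopSet i n' ω')
        ((hset t (le_of_mem_stopSet hω hmin hn ht)).1 ht)
  have hle : ω c ≤ visitTime i n ω := by
    rw [hv]
    exact le_add_of_nonneg_right (visitTime_nonneg i n' ω')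
  have hsub : visitTime i n ω - ω c = visitTime i n' ω' := by rw [hv, add_sub_cancel_left]
  funext j
  have := hn' j
  simp only [endState]
  rw [arrivals_residual hω c hle, services_residual hω c hle, ← hω', hsub]
  by_cases hj : j = i
  · simp only [hj, and_true, if_true] at this ⊢
    omega
  · simp only [hj, and_false, if_false] at this ⊢
    omega

end Polling

/-! ### The first-step equation -/

namespace Polling

variable {M : ℕ}

theorem norm_monomial_le_one {z : Fin M → ℂ} (hz : ∀ j, ‖z j‖ ≤ 1) (n : State M) :
    ‖∏ j, z j ^ n j‖ ≤ 1 := by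
  rw [norm_prod]
  refine Finset.prod_le_one (fun _ _ => norm_nonneg _) fun j _ => ?_
  rw [norm_pow]
  exact pow_le_one₀ (norm_nonneg _) (hz j)

theorem integrable_monomial {z : Fin M → ℂ} (hz : ∀ j, ‖z j‖ ≤ 1) (ν : Measure (State M))
    [IsFiniteMeasure ν] : Integrable (fun n : State M => ∏ j, z j ^ n j) ν :=
  Integrable.of_bound (measurable_of_countable _).aestronglyMeasurable 1
    (Filter.Eventually.of_forall (norm_monomial_le_one hz))

theorem norm_pgf_le_one {z : Fin M → ℂ} (hz : ∀ j, ‖z j‖ ≤ 1) (ν : Measure (State M))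
    [IsProbabilityMeasure ν] : ‖pgf ν z‖ ≤ 1 := by
  simpa [pgf] using norm_integral_le_of_norm_le_const (μ := ν)
    (Filter.Eventually.of_forall (norm_monomial_le_one hz))

theorem pgf_conv (z : Fin M → ℂ) (μ ν : Measure (State M))
    [IsFiniteMeasure μ] [IsFiniteMeasure ν] : pgf (μ.conv ν) z = pgf μ z * pgf ν z := by
  simp only [pgf]
  rw [Measure.conv, integral_map (by fun_prop)
    (measurable_of_countable _).aestronglyMeasurable, ← integral_prod_mul]
  simp only [Pi.add_apply, pow_add, Finset.prod_mul_distrib]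

theorem pgf_bind {z : Fin M → ℂ} (hz : ∀ j, ‖z j‖ ≤ 1) (ν : Measure (State M))
    [IsFiniteMeasure ν] (κ : Kernel (State M) (State M)) [IsMarkovKernel κ] :
    pgf (ν.bind κ) z = ∫ n, pgf (κ n) z ∂ν :=
  Kernel.integral_comp (κ := Kernel.const Unit ν) (η := κ) (a := ()) (integrable_monomial hz _)

namespace Model

variable (P : Model M) (i : Fin M) {z : Fin M → ℂ}

instance : IsProbabilityMeasure (P.clockLaw i) := by
  unfold clockLaw
  infer_instance

instance : IsMarkovKernel (P.timeLimited i) :=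
  ⟨fun n => Measure.isProbabilityMeasure_map (P.aemeasurable_endState i n)⟩

theorem pgf_timeLimited_eq_integral (z : Fin M → ℂ) (n : State M) :
    pgf (P.timeLimited i n) z = ∫ ω, ∏ j, z j ^ endState i n ω j ∂P.clockLaw i :=
  integral_map (P.aemeasurable_endState i n) (measurable_of_countable _).aestronglyMeasurable

theorem pgf_timeLimited_of_eq_zero (z : Fin M → ℂ) {n : State M} (hn : n i = 0) :
    pgf (P.timeLimited i n) z = ∏ j, z j ^ n j := by
  rw [pgf_timeLimited_eq_integral, integral_congr_ae (g := fun _ => ∏ j, z j ^ n j)]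
  · simp
  · filter_upwards [P.ae_isRegular i] with ω hω
    rw [endState_of_eq_zero hω hn]

theorem sum_rate_firstClocks : ∑ c ∈ firstClocks M, P.rate i c = P.totalRate i :=
  sum_firstClocks _

theorem totalRate_pos : 0 < P.totalRate i := by
  rw [← sum_rate_firstClocks]
  exact Finset.sum_pos (fun c _ => P.rate_pos i c) ⟨.timer, by simp [firstClocks]⟩

/-- The contribution of the paths whose first event is an arrival or a service completion. -/
theorem setIntegral_endState {c : Clock M} (hc : c ∈ firstClocks M) (hct : c ≠ .timer)
    (z : Fin M → ℂ) {n n' : State M} (hn : n i ≠ 0)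
    (hn' : ∀ j, n' j + (if c = .service 0 ∧ j = i then 1 else 0) =
      n j + if c = .arrival j 0 then 1 else 0) :
    ∫ ω in ringsFirst (firstClocks M) c, ∏ j, z j ^ endState i n ω j ∂P.clockLaw i =
      (P.rate i c / P.totalRate i : ℝ) * pgf (P.timeLimited i n') z := by
  have hF : AEStronglyMeasurable (fun ω => ∏ j, z j ^ endState i n' ω j) (P.clockLaw i) :=
    ((measurable_of_countable fun m : State M => ∏ j, z j ^ m j).comp_aemeasurable
      (P.aemeasurable_endState i n')).aestronglyMeasurable
  rw [pgf_timeLimited_eq_integral, ← sum_rate_firstClocks]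
  refine Eq.trans ?_ (setIntegral_ringsFirst_residual (P.rate_pos i) hc (advance_injective c)
    (fun d hd => advance_of_mem_erase hd) (P.rate_advance i c) (advance_ne hc hct) hF)
  refine setIntegral_congr_ae (measurableSet_ringsFirst _ _) ?_
  filter_upwards [P.ae_isRegular i] with ω hω hmin
  rw [endState_eq_endState_residual hω hmin hct hn hn']

/-- The first-step equation for the p.g.f. at the end of a visit, found by splitting the sample space
according to the clock which rings first. -/
theorem totalRate_mul_pgf_timeLimited (hz : ∀ j, ‖z j‖ ≤ 1) {n : State M} (hn : n i ≠ 0) :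
    P.totalRate i * pgf (P.timeLimited i n) z = P.alpha i * ∏ j, z j ^ n j +
      (1 / P.b i * pgf (P.timeLimited i (n - Pi.single i 1)) z +
        ∑ j, P.lam j * pgf (P.timeLimited i (n + Pi.single j 1)) z) := by
  have hint : Integrable (fun ω => ∏ j, z j ^ endState i n ω j) (P.clockLaw i) :=
    (integrable_monomial hz _).comp_aemeasurable (P.aemeasurable_endState i n)
  have hdec := integral_eq_sum_ringsFirst (P.rate_pos i) (H := firstClocks M)
    ⟨.timer, by simp [firstClocks]⟩ hint
  have htimer : ∫ ω in ringsFirst (firstClocks M) .timer, ∏ j, z j ^ endState i n ω j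
      ∂P.clockLaw i = (P.alpha i / P.totalRate i : ℝ) * ∏ j, z j ^ n j := by
    rw [setIntegral_congr_ae (g := fun _ => ∏ j, z j ^ n j) (measurableSet_ringsFirst _ _)]
    · have := infinitePi_ringsFirst (P.rate_pos i) (H := firstClocks M) (c := .timer)
        (by simp [firstClocks])
      rw [setIntegral_const, Measure.real, clockLaw, this, sum_rate_firstClocks,
        ENNReal.toReal_ofReal (div_nonneg (P.rate_pos i _).le (P.totalRate_pos i).le),
        Complex.real_smul]
      rfl
    · filter_upwards [P.ae_isRegular i] with ω hω hmin
      rw [endState_of_timer_first hω hmin hn]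
  have hservice := P.setIntegral_endState i (c := .service 0) (by simp [firstClocks]) (by simp) z
    hn (n' := n - Pi.single i 1) fun j => by
      by_cases hj : j = i
      · subst hj
        simpa using Nat.sub_add_cancel (Nat.one_le_iff_ne_zero.2 hn)
      · simp [hj]
  have harrival := fun j => P.setIntegral_endState i (c := .arrival j 0) (by simp [firstClocks])
    (by simp) z hn (n' := n + Pi.single j 1) fun l => by
      by_cases hl : j = l
      · subst hl
        simp
      · simp [hl, Ne.symm hl]
  have hT : (P.totalRate i : ℂ) ≠ 0 := by exact_mod_cast (P.totalRate_pos i).ne'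
  change ∫ ω, _ ∂P.clockLaw i = ∑ c ∈ firstClocks M, ∫ ω in _, _ ∂P.clockLaw i at hdec
  rw [pgf_timeLimited_eq_integral, hdec, sum_firstClocks, htimer, hservice,
    Finset.sum_congr rfl fun j _ => harrival j, mul_add, mul_add, Finset.mul_sum]
  simp only [rate]
  push_cast
  congr 1
  · field_simp
  · congr 1
    · field_simp
    · refine Finset.sum_congr rfl fun j _ => ?_
      field_simp

/-- A bounded function of the queue lengths that vanishes when queue `i` is empty and is otherwise
preserved by the first step of a visit vanishes: at each step the timer may expire, so the step is
a contraction for the supremum norm. -/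
theorem eq_zero_of_first_step {f : State M → ℂ} {K : ℝ} (hK : ∀ n, ‖f n‖ ≤ K)
    (h0 : ∀ n, n i = 0 → f n = 0)
    (h1 : ∀ n, n i ≠ 0 → P.totalRate i * f n =
      1 / P.b i * f (n - Pi.single i 1) + ∑ j, P.lam j * f (n + Pi.single j 1)) (n : State M) :
    f n = 0 := by
  have hT := P.totalRate_pos i
  have ha := P.alpha_pos i
  have hb := P.b_pos i
  set q := (P.totalRate i - P.alpha i) / P.totalRate i with hq
  have hq' : P.totalRate i - P.alpha i = 1 / P.b i + ∑ j, P.lam j := by rw [totalRate]; ring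
  have hsum : 0 ≤ ∑ j, P.lam j := Finset.sum_nonneg fun j _ => (P.lam_pos j).le
  have hq0 : 0 ≤ q := div_nonneg (by rw [hq']; positivity) hT.le
  have hq1 : q < 1 := by
    rw [hq, div_lt_one hT]
    linarith
  have hK0 : 0 ≤ K := (norm_nonneg _).trans (hK n)
  have hpow : ∀ k : ℕ, ∀ n, ‖f n‖ ≤ q ^ k * K := fun k => by
    induction k with
    | zero => simpa using hK
    | succ k ih =>
      intro n
      by_cases hn : n i = 0
      · rw [h0 n hn, norm_zero]
        positivity
      · have hstep : ‖(P.totalRate i : ℂ) * f n‖ ≤ (P.totalRate i - P.alpha i) * (q ^ k * K) := by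
          rw [h1 n hn, hq', add_mul, Finset.sum_mul]
          refine (norm_add_le _ _).trans (add_le_add ?_ ((norm_sum_le _ _).trans
            (Finset.sum_le_sum fun j _ => ?_)))
          · rw [norm_mul, norm_div, norm_one, Complex.norm_real, Real.norm_of_nonneg hb.le]
            exact mul_le_mul_of_nonneg_left (ih _) (by positivity)
          · rw [norm_mul, Complex.norm_real, Real.norm_of_nonneg (P.lam_pos j).le]
            exact mul_le_mul_of_nonneg_left (ih _) (P.lam_pos j).le
        rw [norm_mul, Complex.norm_real, Real.norm_of_nonneg hT.le, ← le_div_iff₀' hT] at hstep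
        refine hstep.trans_eq ?_
        rw [hq, pow_succ]
        ring
  have hlim : Filter.Tendsto (fun k : ℕ => q ^ k * K) Filter.atTop (nhds 0) := by
    simpa using (tendsto_pow_atTop_nhds_zero_of_lt_one hq0 hq1).mul_const K
  exact norm_le_zero_iff.1 (ge_of_tendsto' hlim fun k => hpow k n)

theorem norm_star_le_one (hz : ∀ j, ‖z j‖ ≤ 1) (j : Fin M) : ‖P.star i z j‖ ≤ 1 := by
  by_cases hj : j = i
  · subst hj
    simpa [star] using (P.norm_root_lt_one j hz).le
  · simpa [star, hj] using hz j

theorem endPgf_eq_monomials (z : Fin M → ℂ) (n : State M) : P.endPgf i z n =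
    (1 + P.alpha i * z i / P.poly i z (z i)) * ∏ j, P.star i z j ^ n j -
      P.alpha i * z i / P.poly i z (z i) * ∏ j, z j ^ n j := by
  have h : ∏ j ∈ Finset.univ.erase i, P.star i z j ^ n j = ∏ j ∈ Finset.univ.erase i, z j ^ n j :=
    Finset.prod_congr rfl fun j hj => by simp [star, Finset.ne_of_mem_erase hj]
  rw [← Finset.mul_prod_erase _ _ (Finset.mem_univ i),
    ← Finset.mul_prod_erase _ (fun j => z j ^ n j) (Finset.mem_univ i), h, endPgf]
  simp only [star, Function.update_self]
  ring

theorem norm_endPgf_le (hz : ∀ j, ‖z j‖ ≤ 1) (n : State M) : ‖P.endPgf i z n‖ ≤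
    ‖1 + P.alpha i * z i / P.poly i z (z i)‖ + ‖P.alpha i * z i / P.poly i z (z i)‖ := by
  rw [endPgf_eq_monomials]
  refine (norm_sub_le _ _).trans (add_le_add ?_ ?_) <;> rw [norm_mul]
  · exact mul_le_of_le_one_right (norm_nonneg _)
      (norm_monomial_le_one (P.norm_star_le_one i hz) n)
  · exact mul_le_of_le_one_right (norm_nonneg _) (norm_monomial_le_one hz n)

theorem pgf_timeLimited (hz : ∀ j, ‖z j‖ ≤ 1) (hP : P.poly i z (z i) ≠ 0) (n : State M) :
    pgf (P.timeLimited i n) z = P.endPgf i z n := by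
  refine sub_eq_zero.1 (P.eq_zero_of_first_step i
    (f := fun n => pgf (P.timeLimited i n) z - P.endPgf i z n)
    (fun n => (norm_sub_le _ _).trans
      (add_le_add (norm_pgf_le_one hz _) (P.norm_endPgf_le i hz n)))
    (fun n hn => ?_) (fun n hn => ?_) n)
  · simp only [P.pgf_timeLimited_of_eq_zero i z hn, P.endPgf_of_eq_zero i hn, sub_self]
  · simp only [mul_sub, P.totalRate_mul_pgf_timeLimited i hz hn, P.totalRate_mul_endPgf i hz hP hn,
      Finset.sum_sub_distrib]
    ring

theorem pgf_bind_timeLimited (hz : ∀ j, ‖z j‖ ≤ 1) (hP : P.poly i z (z i) ≠ 0)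
    (ν : Measure (State M)) [IsProbabilityMeasure ν] :
    pgf (ν.bind (P.timeLimited i)) z =
      (1 + P.alpha i * z i / P.poly i z (z i)) * pgf ν (P.star i z) -
        P.alpha i * z i / P.poly i z (z i) * pgf ν z := by
  rw [pgf_bind hz]
  simp only [P.pgf_timeLimited i hz hP, endPgf_eq_monomials]
  rw [integral_sub ((integrable_monomial (P.norm_star_le_one i hz) ν).const_mul _)
    ((integrable_monomial hz ν).const_mul _), integral_const_mul, integral_const_mul]
  rfl

instance (j : Fin M) : IsFiniteMeasure (P.switchArrivals j) := by
  have := P.C_prob j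
  unfold switchArrivals
  infer_instance

end Model
end Polling

/-! ### The kernel relations -/

theorem mainTheorem2 {M : ℕ} [NeZero M] (P : Polling.Model M) (i : Fin M) :
    -- the root `r_{1i}` lies in the open unit disc, and is the only root of `P_i` in the closed one
    (∀ z : Fin M → ℂ, (∀ j, ‖z j‖ ≤ 1) →
      ‖P.root i z‖ < 1 ∧ ∀ w : ℂ, ‖w‖ ≤ 1 → (P.poly i z w = 0 ↔ w = P.root i z)) ∧
    -- conditional form, given the queue lengths `n` at the beginning of the visit
    (∀ (n : Polling.State M) (z : Fin M → ℂ), (∀ j, ‖z j‖ ≤ 1) → P.poly i z (z i) ≠ 0 →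
      Polling.pgf (P.timeLimited i n) z =
        (∏ j ∈ Finset.univ.erase i, z j ^ n j) *
          (P.root i z ^ n i - P.alpha i * z i / P.poly i z (z i) *
            (z i ^ n i - P.root i z ^ n i))) ∧
    -- kernel relation, for an arbitrary law of the queue lengths at the beginning of the visit
    (∀ ν : MeasureTheory.Measure (Polling.State M), MeasureTheory.IsProbabilityMeasure ν →
      ∀ z : Fin M → ℂ, (∀ j, ‖z j‖ ≤ 1) → P.poly i z (z i) ≠ 0 →
        Polling.pgf (ν.bind (P.timeLimited i)) z =
          (1 + P.alpha i * z i / P.poly i z (z i)) * Polling.pgf ν (P.star i z)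
            - P.alpha i * z i / P.poly i z (z i) * Polling.pgf ν z) ∧
    -- kernel relation and recursion in steady state, when queue `i` is time-limited
    (∀ (V : Fin M → ProbabilityTheory.Kernel (Polling.State M) (Polling.State M))
      (β γ : Fin M → MeasureTheory.Measure (Polling.State M)),
      V i = P.timeLimited i → P.IsSteadyState V β γ →
      ∀ z : Fin M → ℂ, (∀ j, ‖z j‖ ≤ 1) → P.poly i z (z i) ≠ 0 →
        Polling.pgf (γ i) z =
            (1 + P.alpha i * z i / P.poly i z (z i)) * Polling.pgf (β i) (P.star i z)
              - P.alpha i * z i / P.poly i z (z i) * Polling.pgf (β i) z ∧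
        Polling.pgf (γ i) z =
            (1 + P.alpha i * z i / P.poly i z (z i)) *
                (Polling.pgf (γ (i - 1)) (P.star i z) *
                  Polling.pgf (P.switchArrivals (i - 1)) (P.star i z))
              - P.alpha i * z i / P.poly i z (z i) *
                (Polling.pgf (γ (i - 1)) z * Polling.pgf (P.switchArrivals (i - 1)) z)) := by
  -- the visit equation of the steady state is an instance of the relation for an arbitrary law
  have hrel : ∀ (V : Fin M → ProbabilityTheory.Kernel (Polling.State M) (Polling.State M))
      (β γ : Fin M → MeasureTheory.Measure (Polling.State M)),
      V i = P.timeLimited i → P.IsSteadyState V β γ →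
      ∀ z : Fin M → ℂ, (∀ j, ‖z j‖ ≤ 1) → P.poly i z (z i) ≠ 0 →
        Polling.pgf (γ i) z =
          (1 + P.alpha i * z i / P.poly i z (z i)) * Polling.pgf (β i) (P.star i z)
            - P.alpha i * z i / P.poly i z (z i) * Polling.pgf (β i) z := by
    intro V β γ hV h z hz hP
    have := h.prob_begin i
    rw [h.visit i, hV]
    exact P.pgf_bind_timeLimited i hz hP (β i)
  refine ⟨fun z hz => ⟨P.norm_root_lt_one i hz, fun w hw => P.poly_eq_zero_iff i hz hw⟩,
    fun n z hz hP => P.pgf_timeLimited i hz hP n,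
    fun ν _ z hz hP => P.pgf_bind_timeLimited i hz hP ν, fun V β γ hV h z hz hP => ?_⟩
  refine ⟨hrel V β γ hV h z hz hP, ?_⟩
  have := h.prob_end (i - 1)
  rw [hrel V β γ hV h z hz hP, h.switch i, Polling.pgf_conv, Polling.pgf_conv]
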